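/- Let $K\ge 0$, let $\mathcal E,\mathcal I$ be finite index sets, $a_i\in\mathbb R^n$, $b_i\in\mathbb R$ ($i\in\mathcal E$), let $\omega_j:\mathbb R^n\to\mathbb R$ ($j\in\mathcal I$) be convex and continuously differentiable, and set $$\mathcal X=\{x\in\mathbb R^n:\ a_i^Tx+b_i=0\ (i\in\mathcal E),\ \omega_j(x)\le 0\ (j\in\mathcal I)\}.$$ Let $g,h$ be continuous convex functions on an open convex set $U\supseteq\mathcal X$, with $g$ $\rho$-strongly convex on $U$ for some $\rho\ge 0$, and let $G_i,H_i:\mathbb R^n\to\mathbb R$ ($i=1,\dots,K$) be continuous and convex. Consider the problem $$\min_{x\in\mathcal X}\ f(x):=g(x)-h(x)\quad\text{s.t.}\quad G_i(x)-H_i(x)\le 0,\ i=1,\dots,K, \qquad(\mathrm{P})$$ and let $\bar{\mathcal X}$ be its feasible set. Here $\partial$ denotes the convex subdifferential and $\mathcal N_{\mathcal X}(x)$ the normal cone of $\mathcal X$ at $x$. Assume the generalized MFCQ: for every $x\in\bar{\mathcal X}$ at which $G_i(x)=H_i(x)$ for at least one $i$, there is $y\in\mathcal X$ such that $$G_i(y)-H_i(x)-\langle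 s,y-x\rangle<0\quad\text{for all } i \text{ with } G_i(x)=H_i(x)\text{ and all } s\in\partial H_i(x),$$ $$\langle\nabla\omega_j(x),y-x\rangle<0\quad\text{for all } j\in\mathcal I\text{ with }\omega_j(x)=0.$$ Let $\beta\ge 0$ with $\rho+\beta>0$, let $x^0\in\bar{\mathcal X}$, and let $\{x^k\}$ be generated by the proximal DC iterations: for each $k\ge 0$, choose any $s_h^k\in\partial h(x^k)$ and $s_{H_i}^k\in\partial H_i(x^k)$, $i=1,\dots,K$, and let $x^{k+1}$ be any minimizer of $$g(x)-h(x^k)-\langle s_h^k,x-x^k\rangle+\tfrac{\beta}{2}\|x-x^k\|^2$$ over all $x\in\mathcal X$ with $G_i(x)-H_i(x^k)-\langle s_{H_i}^k,x-x^k\rangle\le 0$ for $i=1,\dots,K$. Suppose that the level set $\{x\in\bar{\mathcal X}: f(x)\le f(x^0)\}$ is bounded. Then every accumulation point $x^*$ of $\{x^k\}$ is a KKT point of $(\mathrm{P})$, that is, $x^*\in\bar{\mathcal X}$ and there are $\lambda_1,\dots,\lambda_K\ge 0$ with $\lambda_i\,(G_i(x^*)-H_i(x^*))=0$ for all $i$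 and $$0\in\partial g(x^*)-\partial h(x^*)+\sum_{i=1}^K\lambda_i\big(\partial G_i(x^*)-\partial H_i(x^*)\big)+\mathcal N_{\mathcal X}(x^*).$$ -/

import Mathlib

open Filter Topology
open scoped InnerProductSpace

namespace ProxDC

/-- The convex subdifferential at `x` of a function `φ` whose effective domain is `U`
(that is, `φ` is understood to be `+∞` outside `U`): all `s` with
`φ y ≥ φ x + ⟪s, y - x⟫` for every `y ∈ U`. -/
def subdiff {n : ℕ} (U : Set (EuclideanSpace ℝ (Fin n))) (φ : EuclideanSpace ℝ (Fin n) → ℝ)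
    (x : EuclideanSpace ℝ (Fin n)) : Set (EuclideanSpace ℝ (Fin n)) :=
  {s | ∀ y ∈ U, φ x + ⟪s, y - x⟫_ℝ ≤ φ y}

/-- The normal cone of a convex set `X` at `x ∈ X`, i.e. the convex subdifferential of the
indicator function of `X`. -/
def normalCone {n : ℕ} (X : Set (EuclideanSpace ℝ (Fin n))) (x : EuclideanSpace ℝ (Fin n)) :
    Set (EuclideanSpace ℝ (Fin n)) :=
  {v | ∀ y ∈ X, ⟪v, y - x⟫_ℝ ≤ 0}

/-- The set `X` described by the affine equalities `⟪a i, x⟫ + b i = 0` and the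
inequalities `ω j x ≤ 0`. -/
def constraintSet {n : ℕ} {ιE ιI : Type*} (a : ιE → EuclideanSpace ℝ (Fin n)) (b : ιE → ℝ)
    (ω : ιI → EuclideanSpace ℝ (Fin n) → ℝ) : Set (EuclideanSpace ℝ (Fin n)) :=
  {x | (∀ i, ⟪a i, x⟫_ℝ + b i = 0) ∧ ∀ j, ω j x ≤ 0}

/-- The feasible set of the problem with the DC constraints `G i - H i ≤ 0`, `x ∈ X`. -/
def feasibleSet {n K : ℕ} (X : Set (EuclideanSpace ℝ (Fin n)))
    (G H : Fin K → EuclideanSpace ℝ (Fin n) → ℝ) : Set (EuclideanSpace ℝ (Fin n)) :=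
  {x | x ∈ X ∧ ∀ i, G i x - H i x ≤ 0}

/-- The generalized Mangasarian-Fromovitz constraint qualification for several DC constraints,
over `X = constraintSet a b ω`: for each feasible `x` at which some DC constraint is active there
is one `y ∈ X` that satisfies the strict inequalities of all active DC constraints (for all
subgradients of `H i` at `x`) and of all active inequality constraints `ω j`. -/
def GeneralizedMFCQ {n K : ℕ} {ιE ιI : Type*} (a : ιE → EuclideanSpace ℝ (Fin n)) (b : ιE → ℝ)
    (ω : ιI → EuclideanSpace ℝ (Fin n) → ℝ) (G H : Fin K → EuclideanSpace ℝ (Fin n) → ℝ) : Prop :=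
  ∀ x ∈ feasibleSet (constraintSet a b ω) G H, (∃ i, G i x = H i x) →
    ∃ y ∈ constraintSet a b ω,
      (∀ i, G i x = H i x → ∀ s ∈ subdiff Set.univ (H i) x, G i y - H i x - ⟪s, y - x⟫_ℝ < 0) ∧
      (∀ j, ω j x = 0 → ⟪gradient (ω j) x, y - x⟫_ℝ < 0)

/-- The feasible set of the convex subproblem at the current point `z`, with chosen subgradients
`sH i` of `H i` at `z`. -/
def subproblemSet {n K : ℕ} (X : Set (EuclideanSpace ℝ (Fin n)))
    (G H : Fin K → EuclideanSpace ℝ (Fin n) → ℝ) (z : EuclideanSpace ℝ (Fin n))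
    (sH : Fin K → EuclideanSpace ℝ (Fin n)) : Set (EuclideanSpace ℝ (Fin n)) :=
  {x | x ∈ X ∧ ∀ i, G i x - H i z - ⟪sH i, x - z⟫_ℝ ≤ 0}

/-- The objective of the convex subproblem at the current point `z`, with a chosen subgradient
`sh` of `h` at `z`. -/
noncomputable def subproblemObj {n : ℕ} (g h : EuclideanSpace ℝ (Fin n) → ℝ) (β : ℝ)
    (z sh x : EuclideanSpace ℝ (Fin n)) : ℝ :=
  g x - h z - ⟪sh, x - z⟫_ℝ + β / 2 * ‖x - z‖ ^ 2

/-- `x` is a sequence of iterates of the proximal DC algorithm: `x 0` is feasible, and for every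
`k`, for some subgradients of `h` and of the `H i` at `x k`, the point `x (k + 1)` is a minimizer
of the resulting convex subproblem. -/
def IsProxDCSequence {n K : ℕ} (X U : Set (EuclideanSpace ℝ (Fin n)))
    (g h : EuclideanSpace ℝ (Fin n) → ℝ) (G H : Fin K → EuclideanSpace ℝ (Fin n) → ℝ) (β : ℝ)
    (x : ℕ → EuclideanSpace ℝ (Fin n)) : Prop :=
  x 0 ∈ feasibleSet X G H ∧
  ∀ k, ∃ sh ∈ subdiff U h (x k), ∃ sH : Fin K → EuclideanSpace ℝ (Fin n),
    (∀ i, sH i ∈ subdiff Set.univ (H i) (x k)) ∧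
    x (k + 1) ∈ subproblemSet X G H (x k) sH ∧
    IsMinOn (subproblemObj g h β (x k) sh) (subproblemSet X G H (x k) sH) (x (k + 1))

/-- KKT points: `x` is feasible and there are multipliers `l i ≥ 0` with `l i * (G i x - H i x) = 0`
and `0 ∈ ∂g(x) - ∂h(x) + ∑ i, l i • (∂(G i)(x) - ∂(H i)(x)) + N_X(x)`. -/
def IsKKTPoint {n K : ℕ} (X U : Set (EuclideanSpace ℝ (Fin n)))
    (g h : EuclideanSpace ℝ (Fin n) → ℝ) (G H : Fin K → EuclideanSpace ℝ (Fin n) → ℝ)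
    (x : EuclideanSpace ℝ (Fin n)) : Prop :=
  x ∈ feasibleSet X G H ∧
  ∃ l : Fin K → ℝ, (∀ i, 0 ≤ l i) ∧ (∀ i, l i * (G i x - H i x) = 0) ∧
    ∃ sg ∈ subdiff U g x, ∃ sh ∈ subdiff U h x,
    ∃ sG : Fin K → EuclideanSpace ℝ (Fin n), (∀ i, sG i ∈ subdiff Set.univ (G i) x) ∧
    ∃ sH : Fin K → EuclideanSpace ℝ (Fin n), (∀ i, sH i ∈ subdiff Set.univ (H i) x) ∧
    ∃ v ∈ normalCone X x,
      0 = sg - sh + ∑ i, l i • (sG i - sH i) + v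

end ProxDC

/-! Comparing `x (k + 1)` with the midpoint of `x k` and `x (k + 1)` gives a decrease of `g - h`
proportional to the squared step. At a cluster point `g - h` is continuous, so the values are
bounded below and the steps vanish (`IsProxDCSequence.tendsto_norm_sub`). Along an ultrafilter
converging to the cluster point, the chosen subgradients, which are locally bounded, also converge
(`exists_tendsto_subdiff`).

A point strictly feasible for the limiting linearized constraints is eventually feasible for the
subproblems, so minimality passes to the limit against such points. The proximal term is second
order along segments and drops out (`le_of_le_add_sq`).

The constraint qualification supplies a Slater point of the limiting convex program
(`GeneralizedMFCQ.exists_slater`), hence multipliers. Sum rules obtained by separation then split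
the Lagrangian minimality into the KKT inclusion (`isKKTPoint_of_forall_le`). `X` stays an abstract
convex set throughout, represented by its normal cone. -/

namespace ProxDC

/-! ### Subdifferential calculus -/

section Subdifferential

variable {n : ℕ} {U X : Set (EuclideanSpace ℝ (Fin n))} {φ ψ : EuclideanSpace ℝ (Fin n) → ℝ}
  {x : EuclideanSpace ℝ (Fin n)}

/-- Subgradients pass to the limit along any filter. -/
theorem mem_subdiff_of_tendsto {α : Type*} {l : Filter α} [l.NeBot]
    {u s : α → EuclideanSpace ℝ (Fin n)} {t : EuclideanSpace ℝ (Fin n)}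
    (hφ : ContinuousAt φ x) (hu : Tendsto u l (𝓝 x)) (hs : Tendsto s l (𝓝 t))
    (hmem : ∀ k, s k ∈ subdiff U φ (u k)) : t ∈ subdiff U φ x := by
  intro y hy
  have h1 : Tendsto (fun k => φ (u k) + ⟪s k, y - u k⟫_ℝ) l (𝓝 (φ x + ⟪t, y - x⟫_ℝ)) :=
    (hφ.tendsto.comp hu).add (hs.inner (tendsto_const_nhds.sub hu))
  exact le_of_tendsto h1 (Eventually.of_forall fun k => hmem k y hy)

/-- Subgradients are bounded near a point of continuity in the interior of the domain. -/
theorem exists_eventually_norm_subdiff_le (hU : U ∈ 𝓝 x) (hφ : ContinuousAt φ x) :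
    ∃ C : ℝ, ∀ᶠ z in 𝓝 x, ∀ s ∈ subdiff U φ z, ‖s‖ ≤ C := by
  have hev : ∀ᶠ z in 𝓝 x, z ∈ U ∧ dist (φ z) (φ x) < 1 :=
    (show ∀ᶠ z in 𝓝 x, z ∈ U from hU).and (Metric.tendsto_nhds.1 hφ.tendsto 1 one_pos)
  obtain ⟨r, hr, hball⟩ := Metric.eventually_nhds_iff.1 hev
  -- A step of length `r / 4` along `s` stays in the ball, where `φ` varies by less than 2; hence `r
  -- / 4 * ‖s‖ ≤ 2`.
  refine ⟨4 * 2 / r, Metric.eventually_nhds_iff.2 ⟨r / 2, by positivity, fun z hz s hs => ?_⟩⟩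
  rcases eq_or_ne s 0 with rfl | hs0
  · rw [norm_zero]; positivity
  have hn : 0 < ‖s‖ := norm_pos_iff.2 hs0
  have hd : dist (z + (r / 4 / ‖s‖) • s) x < r := by
    have h1 : dist (z + (r / 4 / ‖s‖) • s) z = r / 4 := by
      rw [dist_eq_norm, add_sub_cancel_left, norm_smul, Real.norm_of_nonneg (by positivity)]
      field_simp
    linarith [dist_triangle (z + (r / 4 / ‖s‖) • s) z x]
  have h2 := (hball hd)
  have h3 := (hball (y := z) (by linarith)).2
  have h4 := hs _ h2.1
  have h5 := h2.2
  rw [Real.dist_eq, abs_lt] at h3 h5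
  rw [add_sub_cancel_left, inner_smul_right, real_inner_self_eq_norm_sq] at h4
  have h6 : r / 4 / ‖s‖ * ‖s‖ ^ 2 = r / 4 * ‖s‖ := by field_simp
  rw [h6] at h4
  rw [le_div_iff₀ hr]
  linarith

/-- Subgradients chosen along an ultrafilter that converges to an interior point of continuity
converge to a subgradient. -/
theorem exists_tendsto_subdiff {α : Type*} {l : Ultrafilter α}
    {u s : α → EuclideanSpace ℝ (Fin n)} (hU : U ∈ 𝓝 x) (hφ : ContinuousAt φ x)
    (hu : Tendsto u l (𝓝 x)) (hmem : ∀ k, s k ∈ subdiff U φ (u k)) :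
    ∃ t ∈ subdiff U φ x, Tendsto s l (𝓝 t) := by
  obtain ⟨C, hC⟩ := exists_eventually_norm_subdiff_le hU hφ
  have hb : ∀ᶠ k in (l : Filter α), s k ∈ Metric.closedBall (0 : EuclideanSpace ℝ (Fin n)) C := by
    filter_upwards [hu.eventually hC] with k hk
    simpa using hk _ (hmem k)
  obtain ⟨t, -, ht⟩ := (isCompact_closedBall (0 : EuclideanSpace ℝ (Fin n)) C).ultrafilter_le_nhds
    (l.map s) (le_principal_iff.2 hb)
  exact ⟨t, mem_subdiff_of_tendsto hφ hu ht hmem, ht⟩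

/-- The Moreau-Rockafellar sum rule at a minimizer. -/
theorem exists_subdiff_of_isMinOn_add (hU : IsOpen U) (hφ : ConvexOn ℝ U φ)
    (hφc : ContinuousOn φ U) (hψ : ConvexOn ℝ X ψ) (hXU : X ⊆ U) (hx : x ∈ X)
    (hmin : ∀ y ∈ X, φ x + ψ x ≤ φ y + ψ y) :
    ∃ s ∈ subdiff U φ x, -s ∈ subdiff X ψ x := by
  -- Separate the open strict epigraph of `φ` from the hypograph of `φ x + ψ x - ψ`; minimality
  -- makes them disjoint.
  set A : Set (EuclideanSpace ℝ (Fin n) × ℝ) := {p | p.1 ∈ U ∧ φ p.1 < p.2}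
  set B : Set (EuclideanSpace ℝ (Fin n) × ℝ) := {p | p.1 ∈ X ∧ p.2 ≤ φ x + ψ x - ψ p.1}
  have hA : Convex ℝ A := hφ.convex_strict_epigraph
  have hAo : IsOpen A := by
    have h1 : IsOpen {p : EuclideanSpace ℝ (Fin n) × ℝ | p.1 ∈ U} := hU.preimage continuous_fst
    have h2 : ContinuousOn (fun p : EuclideanSpace ℝ (Fin n) × ℝ => p.2 - φ p.1) {p | p.1 ∈ U} :=
      continuousOn_snd.sub (hφc.comp continuousOn_fst fun _ hp => hp)
    convert h2.isOpen_inter_preimage h1 isOpen_Ioi (t := Set.Ioi 0) using 1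
    ext p
    simp [A]
  have hB : Convex ℝ B := by
    rintro ⟨p, r⟩ ⟨hp, hr⟩ ⟨q, t⟩ ⟨hq, ht⟩ c d hc hd hcd
    refine ⟨hψ.1 hp hq hc hd hcd, ?_⟩
    have h1 := hψ.2 hp hq hc hd hcd
    simp only [Prod.fst_add, Prod.snd_add, Prod.smul_fst, Prod.smul_snd, smul_eq_mul] at *
    have h2 : c * (φ x + ψ x) + d * (φ x + ψ x) = φ x + ψ x := by rw [← add_mul, hcd, one_mul]
    nlinarith [mul_le_mul_of_nonneg_left hr hc, mul_le_mul_of_nonneg_left ht hd]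
  have hdisj : Disjoint A B := by
    rw [Set.disjoint_left]
    rintro ⟨p, r⟩ ⟨_, h1⟩ ⟨hp, h2⟩
    have := hmin p hp
    simp only at h1 h2
    linarith
  obtain ⟨F, u, hFA, hFB⟩ := geometric_hahn_banach_open hA hAo hB hdisj
  set v := (InnerProductSpace.toDual ℝ (EuclideanSpace ℝ (Fin n))).symm
    (F.comp (ContinuousLinearMap.inl ℝ _ ℝ))
  set c := F (0, 1)
  have hF : ∀ p r, F (p, r) = ⟪v, p⟫_ℝ + r * c := by
    intro p r
    have h1 : ⟪v, p⟫_ℝ = F (p, 0) := by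
      simp [v]
    have h2 : (p, r) = (p, (0 : ℝ)) + r • ((0 : EuclideanSpace ℝ (Fin n)), (1 : ℝ)) := by simp
    rw [h1, h2, map_add, map_smul, smul_eq_mul]
  have hxB : u ≤ F (x, φ x) := hFB _ ⟨hx, by simp⟩
  -- The hyperplane is not vertical: the vertical line over `x` meets both sets. Its slope is the
  -- subgradient.
  have hc : c < 0 := by
    have h1 : F (x, φ x + 1) < u := hFA _ ⟨hXU hx, by simp⟩
    rw [hF] at h1 hxB
    linarith
  have hFA' : ∀ y ∈ U, ⟪v, y⟫_ℝ + φ y * c ≤ u := by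
    intro y hy
    refine le_of_forall_pos_lt_add fun ε hε => ?_
    have h1 : F (y, φ y + ε / (-c)) < u := hFA _ ⟨hy, by
      have : 0 < ε / (-c) := div_pos hε (by linarith)
      simpa using this⟩
    rw [hF] at h1
    have h2 : ε / (-c) * c = -ε := by rw [div_neg, neg_mul, div_mul_cancel₀ _ hc.ne]
    linarith
  rw [hF] at hxB
  have hx' := hFA' x (hXU hx)
  have key : ∀ p q : EuclideanSpace ℝ (Fin n),
      ⟪(-c)⁻¹ • v, p - q⟫_ℝ = (-c)⁻¹ * (⟪v, p⟫_ℝ - ⟪v, q⟫_ℝ) := fun p q => by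
    rw [real_inner_smul_left, inner_sub_right]
  have hc' : 0 < -c := by linarith
  refine ⟨(-c)⁻¹ • v, fun y hy => ?_, fun y hy => ?_⟩
  · have h1 := hFA' y hy
    rw [key, ← le_sub_iff_add_le', inv_mul_le_iff₀ hc']
    nlinarith
  · have h1 : u ≤ F (y, φ x + ψ x - ψ y) := hFB _ ⟨hy, le_rfl⟩
    rw [hF] at h1
    rw [inner_neg_left, key, ← le_sub_iff_add_le', neg_le, le_inv_mul_iff₀ hc']
    nlinarith

/-- Every point minimizes over its own singleton, so the sum rule applies with `X = {x}`. -/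
theorem subdiff_univ_nonempty (hφ : ConvexOn ℝ Set.univ φ) (hφc : Continuous φ) :
    ∃ s, s ∈ subdiff Set.univ φ x := by
  obtain ⟨s, hs, -⟩ := exists_subdiff_of_isMinOn_add (X := {x}) (ψ := fun _ => 0) isOpen_univ hφ
    hφc.continuousOn (convexOn_const 0 (convex_singleton x)) (Set.subset_univ _) rfl
    (by simp)
  exact ⟨s, hs⟩

/-- Lets the multipliers be pulled out of the subgradients. For `c = 0`, testing at `x + s` forces
`s = 0`, and any subgradient of `φ` serves. -/
theorem exists_smul_eq_of_mem_subdiff_mul {c : ℝ} (hc : 0 ≤ c) (hφ : ConvexOn ℝ Set.univ φ)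
    (hφc : Continuous φ) {s : EuclideanSpace ℝ (Fin n)}
    (hs : s ∈ subdiff Set.univ (fun y => c * φ y) x) :
    ∃ t ∈ subdiff Set.univ φ x, s = c • t := by
  rcases hc.eq_or_lt with rfl | hc
  · obtain ⟨t, ht⟩ := subdiff_univ_nonempty (x := x) hφ hφc
    have h1 := hs (x + s) (Set.mem_univ _)
    simp only [zero_mul, zero_add, add_sub_cancel_left, real_inner_self_eq_norm_sq] at h1
    have h2 : ‖s‖ = 0 := by nlinarith [norm_nonneg s]
    exact ⟨t, ht, by rw [zero_smul]; exact norm_eq_zero.1 h2⟩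
  · refine ⟨c⁻¹ • s, fun y hy => ?_, by rw [smul_inv_smul₀ hc.ne']⟩
    have h1 := hs y hy
    rw [real_inner_smul_left, ← le_sub_iff_add_le', inv_mul_le_iff₀ hc]
    linarith

/-- The sum rule for finitely many continuous convex functions on the whole space. -/
theorem exists_subdiff_of_isMinOn_sum {ι : Type*} (t : Finset ι)
    {G : ι → EuclideanSpace ℝ (Fin n) → ℝ} (hG : ∀ i, ConvexOn ℝ Set.univ (G i))
    (hGc : ∀ i, Continuous (G i)) (hx : x ∈ X) :
    ∀ {ψ : EuclideanSpace ℝ (Fin n) → ℝ}, ConvexOn ℝ X ψ →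
    (∀ y ∈ X, ∑ i ∈ t, G i x + ψ x ≤ ∑ i ∈ t, G i y + ψ y) →
    ∃ s : ι → EuclideanSpace ℝ (Fin n), (∀ i, s i ∈ subdiff Set.univ (G i) x) ∧
      -∑ i ∈ t, s i ∈ subdiff X ψ x := by
  classical
  induction t using Finset.induction_on with
  | empty =>
    intro ψ _ hmin
    choose s hs using fun i => subdiff_univ_nonempty (x := x) (hG i) (hGc i)
    refine ⟨s, hs, fun y hy => ?_⟩
    simpa using hmin y hy
  | insert j t hj ih =>
    intro ψ hψ hmin
    simp only [Finset.sum_insert hj] at hmin ⊢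
    obtain ⟨s, hs, hsψ⟩ := ih (((hG j).subset (Set.subset_univ X) hψ.1).add hψ) (by
      intro y hy
      have := hmin y hy
      simp only [Pi.add_apply]
      linarith)
    -- The induction hypothesis, used with `G j + ψ`, says that `x` minimizes `G j` plus this
    -- function.
    have hlin : ConvexOn ℝ X (fun y => ψ y + ⟪∑ i ∈ t, s i, y⟫_ℝ) :=
      hψ.add (((innerSL ℝ (∑ i ∈ t, s i)).toLinearMap.convexOn convex_univ).subset
        (Set.subset_univ X) hψ.1)
    obtain ⟨sj, hsj, hsjψ⟩ := exists_subdiff_of_isMinOn_add isOpen_univ (hG j)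
      (hGc j).continuousOn hlin (Set.subset_univ X) hx (by
        intro y hy
        have := hsψ y hy
        simp only [Pi.add_apply, inner_neg_left, inner_sub_right] at this
        linarith)
    refine ⟨Function.update s j sj, fun i => ?_, fun y hy => ?_⟩
    · rcases eq_or_ne i j with rfl | hij
      · simpa using hsj
      · simpa [hij] using hs i
    · have h1 : ∑ i ∈ t, Function.update s j sj i = ∑ i ∈ t, s i :=
        Finset.sum_congr rfl fun i hi => by
          rw [Function.update_of_ne (ne_of_mem_of_not_mem hi hj)]
      have h2 := hsjψ y hy
      rw [h1, Function.update_self]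
      simp only [inner_neg_left, inner_sub_right, inner_add_left] at h2 ⊢
      linarith

end Subdifferential

/-! ### Convex duality under Slater's condition -/

/-- Lagrange multipliers for a convex program that satisfies Slater's condition; only strictly
feasible points enter the minimality hypothesis. -/
theorem exists_lagrange_multipliers {E ι : Type*} [AddCommGroup E] [Module ℝ E] [Fintype ι]
    {X : Set E} {F : E → ℝ} {c : ι → E → ℝ} {m : ℝ} (hF : ConvexOn ℝ X F)
    (hc : ∀ i, ConvexOn ℝ X (c i)) {y : E} (hy : y ∈ X) (hyc : ∀ i, c i y < 0)
    (hmin : ∀ z ∈ X, (∀ i, c i z < 0) → m ≤ F z) :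
    ∃ l : ι → ℝ, (∀ i, 0 ≤ l i) ∧ ∀ z ∈ X, m ≤ F z + ∑ i, l i * c i z := by
  classical
  -- Strict inequalities make `A` open with no topology on `E`.
  set A : Set (ℝ × (ι → ℝ)) := {p | ∃ z ∈ X, F z < p.1 ∧ ∀ i, c i z < p.2 i}
  have hA : Convex ℝ A := by
    rintro ⟨r, u⟩ ⟨z, hz, hzr, hzu⟩ ⟨r', u'⟩ ⟨z', hz', hzr', hzu'⟩ a b ha hb hab
    have hlt : ∀ {p q p' q' : ℝ}, p < q → p' < q' → a * p + b * p' < a * q + b * q' := by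
      intro p q p' q' h1 h2
      rcases ha.eq_or_lt with rfl | ha
      · have : b = 1 := by linarith
        subst this; linarith
      · nlinarith [mul_lt_mul_of_pos_left h1 ha, mul_le_mul_of_nonneg_left h2.le hb]
    refine ⟨a • z + b • z', hF.1 hz hz' ha hb hab, ?_, fun i => ?_⟩
    · exact (hF.2 hz hz' ha hb hab).trans_lt (hlt hzr hzr')
    · exact ((hc i).2 hz hz' ha hb hab).trans_lt (hlt (hzu i) (hzu' i))
  have hAo : IsOpen A := by
    have : A = ⋃ z ∈ X, {p : ℝ × (ι → ℝ) | F z < p.1 ∧ ∀ i, c i z < p.2 i} := by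
      ext p; simp [A, and_left_comm]
    rw [this]
    refine isOpen_biUnion fun z _ => ?_
    simp only [Set.ofPred_and, Set.ofPred_forall]
    exact (isOpen_lt continuous_const continuous_fst).inter (isOpen_iInter_of_finite fun i =>
      isOpen_lt continuous_const ((continuous_apply i).comp continuous_snd))
  have hm : ((m, 0) : ℝ × (ι → ℝ)) ∉ A := by
    rintro ⟨z, hz, h1, h2⟩
    exact (hmin z hz h2).not_gt h1
  obtain ⟨L, hL⟩ := geometric_hahn_banach_point_open hA hAo hm
  set α := L (1, 0)
  set μ : ι → ℝ := fun i => L (0, Pi.single i 1)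
  have hLf : ∀ r u, L (r, u) = r * α + ∑ i, u i * μ i := by
    intro r u
    have h1 : (r, u) = r • ((1 : ℝ), (0 : ι → ℝ)) + ∑ i, u i • ((0 : ℝ), Pi.single i (1 : ℝ)) := by
      ext j
      · simp [Prod.fst_sum]
      · simp [Prod.snd_sum, Finset.sum_apply, Pi.single_apply]
    rw [h1, map_add, map_smul, map_sum]
    simp only [map_smul, smul_eq_mul, α, μ]
  have hLm : L (m, 0) = m * α := by rw [hLf]; simp
  have hstrict : ∀ z ∈ X, ∀ r, 0 < r → ∀ u : ι → ℝ, (∀ i, 0 < u i) →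
      m * α < (F z + r) * α + ∑ i, (c i z + u i) * μ i := by
    intro z hz r hr u hu
    have := hL (F z + r, fun i => c i z + u i) ⟨z, hz, by simpa using hr, by simpa using hu⟩
    rwa [hLm, hLf] at this
  have hweak : ∀ z ∈ X, ∀ r, 0 ≤ r → ∀ u : ι → ℝ, (∀ i, 0 ≤ u i) →
      m * α ≤ (F z + r) * α + ∑ i, (c i z + u i) * μ i := by
    intro z hz r hr u hu
    have hcont : Continuous fun ε : ℝ => (F z + (r + ε)) * α + ∑ i, (c i z + (u i + ε)) * μ i := by
      fun_prop
    have ht : Tendsto (fun ε : ℝ => (F z + (r + ε)) * α + ∑ i, (c i z + (u i + ε)) * μ i)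
        (𝓝[>] 0) (𝓝 ((F z + r) * α + ∑ i, (c i z + u i) * μ i)) := by
      simpa using (hcont.tendsto 0).mono_left nhdsWithin_le_nhds
    refine ge_of_tendsto ht ?_
    filter_upwards [self_mem_nhdsWithin] with ε hε
    have hε : 0 < ε := hε
    exact (hstrict z hz _ (by linarith) _ fun i => by linarith [hu i]).le
  -- A negative coefficient would violate the bound as its slack grows; the same argument gives
  -- `hμ`.
  have hnonneg : ∀ {p q : ℝ}, (∀ r : ℝ, 0 ≤ r → p ≤ q + r * α) → 0 ≤ α := by
    intro p q h
    by_contra! hα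
    have h1 := h ((|q - p| + 1) / (-α)) (div_nonneg (by positivity) (by linarith))
    have h2 : (|q - p| + 1) / (-α) * α = -(|q - p| + 1) := by
      rw [div_neg, neg_mul, div_mul_cancel₀ _ hα.ne]
    linarith [le_abs_self (q - p)]
  have hα : 0 ≤ α := by
    refine hnonneg (p := m * α) (q := F y * α + ∑ i, c i y * μ i) fun r hr => ?_
    have := hweak y hy r hr 0 (fun _ => le_rfl)
    simp only [Pi.zero_apply, add_zero] at this
    linarith
  have hμ : ∀ i, 0 ≤ μ i := by
    intro i
    by_contra! hi
    set q := F y * α + ∑ i, c i y * μ i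
    have hr : 0 ≤ (|q - m * α| + 1) / (-μ i) := div_nonneg (by positivity) (by linarith)
    have h1 := hweak y hy 0 le_rfl (Pi.single i ((|q - m * α| + 1) / (-μ i))) (fun j => by
      rcases eq_or_ne j i with rfl | hj
      · simpa using hr
      · simp [hj])
    have h2 : (|q - m * α| + 1) / (-μ i) * μ i = -(|q - m * α| + 1) := by
      rw [div_neg, neg_mul, div_mul_cancel₀ _ hi.ne]
    have h3 : ∑ j, (c j y + (Pi.single i ((|q - m * α| + 1) / (-μ i)) : ι → ℝ) j) * μ j
        = ∑ j, c j y * μ j + (|q - m * α| + 1) / (-μ i) * μ i := by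
      simp [add_mul, Finset.sum_add_distrib, Pi.single_apply]
    rw [h3, h2, add_zero] at h1
    linarith [le_abs_self (q - m * α)]
  have hαpos : 0 < α := by
    refine lt_of_le_of_ne hα fun h0 => ?_
    -- The slacks `-c i y` cancel the constraint values, so `α = 0` would give `0 < 0`.
    have h1 := hstrict y hy 1 one_pos (fun i => -c i y) (fun i => by linarith [hyc i])
    simp [← h0] at h1
  refine ⟨fun i => μ i / α, fun i => div_nonneg (hμ i) hα, fun z hz => ?_⟩
  have h1 := hweak z hz 0 le_rfl 0 (fun _ => le_rfl)
  simp only [Pi.zero_apply, add_zero] at h1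
  have h2 : ∑ i, μ i / α * c i z = (∑ i, c i z * μ i) / α := by
    rw [Finset.sum_div]
    exact Finset.sum_congr rfl fun i _ => by ring
  rw [h2, ← mul_le_mul_iff_of_pos_right hαpos, add_mul, div_mul_cancel₀ _ hαpos.ne']
  exact h1

/-! ### Descent, Slater points and KKT conditions -/

section Algorithm

variable {n K : ℕ} {X U : Set (EuclideanSpace ℝ (Fin n))} {g h : EuclideanSpace ℝ (Fin n) → ℝ}
  {G H : Fin K → EuclideanSpace ℝ (Fin n) → ℝ} {ρ β : ℝ}

theorem isClosed_constraintSet {ιE ιI : Type*} {a : ιE → EuclideanSpace ℝ (Fin n)} {b : ιE → ℝ}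
    {ω : ιI → EuclideanSpace ℝ (Fin n) → ℝ} (hω : ∀ j, Continuous (ω j)) :
    IsClosed (constraintSet a b ω) := by
  simp only [constraintSet, Set.ofPred_and, Set.ofPred_forall]
  exact (isClosed_iInter fun i => isClosed_eq (by fun_prop) continuous_const).inter
    (isClosed_iInter fun j => isClosed_le (hω j) continuous_const)

theorem convex_constraintSet {ιE ιI : Type*} {a : ιE → EuclideanSpace ℝ (Fin n)} {b : ιE → ℝ}
    {ω : ιI → EuclideanSpace ℝ (Fin n) → ℝ} (hω : ∀ j, ConvexOn ℝ Set.univ (ω j)) :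
    Convex ℝ (constraintSet a b ω) := by
  intro p hp q hq c d hc hd hcd
  refine ⟨fun i => ?_, fun j => ?_⟩
  · rw [inner_add_right, inner_smul_right, inner_smul_right]
    have h1 : d = 1 - c := by linarith
    subst h1
    linear_combination c * hp.1 i + (1 - c) * hq.1 i
  · have h1 := (hω j).2 (Set.mem_univ p) (Set.mem_univ q) hc hd hcd
    simp only [smul_eq_mul] at h1
    nlinarith [mul_nonpos_of_nonneg_of_nonpos hc (hp.2 j),
      mul_nonpos_of_nonneg_of_nonpos hd (hq.2 j)]

/-- The linearized constraint functions are convex. -/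
theorem convexOn_linearized {φ : EuclideanSpace ℝ (Fin n) → ℝ} {C : Set (EuclideanSpace ℝ (Fin n))}
    (hC : Convex ℝ C) (hφ : ConvexOn ℝ C φ) (r : ℝ) (s z : EuclideanSpace ℝ (Fin n)) :
    ConvexOn ℝ C (fun y => φ y - r - ⟪s, y - z⟫_ℝ) := by
  have h1 : ConvexOn ℝ C (fun y => ⟪-s, y⟫_ℝ) :=
    ((innerSL ℝ (-s)).toLinearMap.convexOn convex_univ).subset (Set.subset_univ _) hC
  refine ((hφ.add h1).add_const (⟪s, z⟫_ℝ - r)).congr fun y _ => ?_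
  simp only [Pi.add_apply, inner_neg_left, inner_sub_right]
  ring

theorem mem_subproblemSet_self {z : EuclideanSpace ℝ (Fin n)} (hz : z ∈ feasibleSet X G H)
    (sH : Fin K → EuclideanSpace ℝ (Fin n)) : z ∈ subproblemSet X G H z sH :=
  ⟨hz.1, fun i => by simpa using hz.2 i⟩

/-- Linearizing `H i` gives a minorant, so the convexified constraints are an inner approximation.
-/
theorem subproblemSet_subset_feasibleSet {z : EuclideanSpace ℝ (Fin n)}
    {sH : Fin K → EuclideanSpace ℝ (Fin n)} (hsH : ∀ i, sH i ∈ subdiff Set.univ (H i) z) :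
    subproblemSet X G H z sH ⊆ feasibleSet X G H :=
  fun y hy => ⟨hy.1, fun i => by linarith [hy.2 i, hsH i y (Set.mem_univ y)]⟩

theorem convex_subproblemSet (hX : Convex ℝ X) (hG : ∀ i, ConvexOn ℝ Set.univ (G i))
    (z : EuclideanSpace ℝ (Fin n)) (sH : Fin K → EuclideanSpace ℝ (Fin n)) :
    Convex ℝ (subproblemSet X G H z sH) := by
  have h1 : subproblemSet X G H z sH
      = X ∩ ⋂ i, {y ∈ Set.univ | G i y - H i z - ⟪sH i, y - z⟫_ℝ ≤ 0} := by
    ext y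
    simp [subproblemSet]
  rw [h1]
  exact hX.inter (convex_iInter fun i =>
    (convexOn_linearized convex_univ (hG i) (H i z) (sH i) z).convex_le 0)

theorem IsProxDCSequence.mem_feasibleSet {x : ℕ → EuclideanSpace ℝ (Fin n)}
    (hx : IsProxDCSequence X U g h G H β x) : ∀ k, x k ∈ feasibleSet X G H
  | 0 => hx.1
  | k + 1 => by
    obtain ⟨sh, -, sH, hsH, hmem, -⟩ := hx.2 k
    exact subproblemSet_subset_feasibleSet hsH hmem

/-- Sufficient decrease of the objective along the iterates. -/
theorem IsProxDCSequence.sufficient_decrease {x : ℕ → EuclideanSpace ℝ (Fin n)}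
    (hx : IsProxDCSequence X U g h G H β x) (hX : Convex ℝ X) (hXU : X ⊆ U)
    (hG : ∀ i, ConvexOn ℝ Set.univ (G i)) (hg : StrongConvexOn U ρ g) (k : ℕ) :
    g (x (k + 1)) - h (x (k + 1)) + (3 * β + ρ) / 4 * ‖x (k + 1) - x k‖ ^ 2
      ≤ g (x k) - h (x k) := by
  obtain ⟨sh, hsh, sH, hsH, hmem, hmin⟩ := hx.2 k
  have hk := hx.mem_feasibleSet k
  have hk1 := hx.mem_feasibleSet (k + 1)
  have hhalf : (0 : ℝ) ≤ 1 / 2 := by norm_num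
  have hmid := convex_subproblemSet hX hG (x k) sH hmem (mem_subproblemSet_self hk sH)
    hhalf hhalf (by norm_num)
  have h1 : subproblemObj g h β (x k) sh (x (k + 1))
      ≤ subproblemObj g h β (x k) sh ((1 / 2 : ℝ) • x (k + 1) + (1 / 2 : ℝ) • x k) := hmin hmid
  have h2 := hg.2 (hXU hk1.1) (hXU hk.1) hhalf hhalf (by norm_num)
  have h3 := hsh _ (hXU hk1.1)
  have h4 : (1 / 2 : ℝ) • x (k + 1) + (1 / 2 : ℝ) • x k - x k
      = (1 / 2 : ℝ) • (x (k + 1) - x k) := by module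
  simp only [subproblemObj, h4, inner_smul_right, norm_smul, smul_eq_mul] at h1 h2
  rw [Real.norm_of_nonneg hhalf, mul_pow] at h1
  linarith

/-- Along the whole sequence, consecutive iterates approach each other once the sequence has a
cluster point. -/
theorem IsProxDCSequence.tendsto_norm_sub {x : ℕ → EuclideanSpace ℝ (Fin n)}
    (hx : IsProxDCSequence X U g h G H β x) (hX : Convex ℝ X) (hXU : X ⊆ U)
    (hG : ∀ i, ConvexOn ℝ Set.univ (G i)) (hg : StrongConvexOn U ρ g) (hβ : 0 ≤ β)
    (hρβ : 0 < ρ + β) {l : Filter ℕ} [l.NeBot] (hl : l ≤ atTop) {z : EuclideanSpace ℝ (Fin n)}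
    (hxz : Tendsto x l (𝓝 z)) (hgz : ContinuousAt g z) (hhz : ContinuousAt h z) :
    Tendsto (fun k => x (k + 1) - x k) atTop (𝓝 0) := by
  set f : ℕ → ℝ := fun k => g (x k) - h (x k)
  set c := (3 * β + ρ) / 4
  have hc : 0 < c := div_pos (by linarith) (by norm_num)
  have hdec : ∀ k, c * ‖x (k + 1) - x k‖ ^ 2 ≤ f k - f (k + 1) := fun k => by
    have := hx.sufficient_decrease hX hXU hG hg k
    simp only [f, c]
    linarith
  have hanti : Antitone f := antitone_nat_of_succ_le fun k => by
    have h1 := hdec k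
    have h2 : 0 ≤ c * ‖x (k + 1) - x k‖ ^ 2 := by positivity
    linarith
  have hlim : Tendsto f l (𝓝 (g z - h z)) :=
    (hgz.tendsto.comp hxz).sub (hhz.tendsto.comp hxz)
  -- An antitone sequence lies above its limit along any nontrivial filter finer than `atTop`.
  have hbdd : BddBelow (Set.range f) := ⟨g z - h z, by
    rintro _ ⟨k, rfl⟩
    exact le_of_tendsto hlim (hl ((eventually_ge_atTop k).mono fun m hm => hanti hm))⟩
  have hconv := tendsto_atTop_ciInf hanti hbdd
  have hdiff : Tendsto (fun k => (f k - f (k + 1)) / c) atTop (𝓝 0) := by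
    simpa using (hconv.sub (hconv.comp (tendsto_add_atTop_nat 1))).div_const c
  have hsq : Tendsto (fun k => ‖x (k + 1) - x k‖ ^ 2) atTop (𝓝 0) :=
    squeeze_zero (fun k => by positivity) (fun k => by
      rw [le_div_iff₀ hc, mul_comm]; exact hdec k) hdiff
  have hsqrt := hsq.sqrt
  simp only [Real.sqrt_sq (norm_nonneg _), Real.sqrt_zero] at hsqrt
  exact tendsto_zero_iff_norm_tendsto_zero.2 hsqrt

/-- A minimizer on a convex set of the sum of a convex function and a proximal term centred at the
minimizer also minimizes the convex function, compared with points joined to it by a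
minimality-preserving segment. -/
theorem le_of_le_add_sq {φ : EuclideanSpace ℝ (Fin n) → ℝ} {C : Set (EuclideanSpace ℝ (Fin n))}
    (hφ : ConvexOn ℝ C φ) {z y : EuclideanSpace ℝ (Fin n)} (hz : z ∈ C) (hy : y ∈ C)
    (h : ∀ t : ℝ, 0 < t → t ≤ 1 →
      φ z ≤ φ ((1 - t) • z + t • y) + β / 2 * ‖(1 - t) • z + t • y - z‖ ^ 2) :
    φ z ≤ φ y := by
  -- The proximal term is of order `t ^ 2`, the convexity gain of order `t`; divide by `t` and let
  -- `t` tend to 0.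
  have h1 : ∀ t : ℝ, 0 < t → t ≤ 1 → φ z ≤ φ y + β / 2 * t * ‖y - z‖ ^ 2 := by
    intro t ht ht1
    have h2 := h t ht ht1
    have h3 := hφ.2 hz hy (sub_nonneg.2 ht1) ht.le (by ring)
    have h4 : (1 - t) • z + t • y - z = t • (y - z) := by module
    rw [h4, norm_smul, Real.norm_of_nonneg ht.le, mul_pow] at h2
    simp only [smul_eq_mul] at h3
    have h5 : t * φ z ≤ t * (φ y + β / 2 * t * ‖y - z‖ ^ 2) := by linarith
    exact le_of_mul_le_mul_left h5 ht
  have hcont : Continuous fun t : ℝ => φ y + β / 2 * t * ‖y - z‖ ^ 2 := by fun_prop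
  have ht : Tendsto (fun t : ℝ => φ y + β / 2 * t * ‖y - z‖ ^ 2) (𝓝[>] 0) (𝓝 (φ y)) := by
    simpa using (hcont.tendsto 0).mono_left nhdsWithin_le_nhds
  refine ge_of_tendsto ht ?_
  filter_upwards [Ioc_mem_nhdsGT (zero_lt_one' ℝ)] with t h3 using h1 t h3.1 h3.2

/-- The constraint qualification yields Slater points for the convexified constraints. -/
theorem GeneralizedMFCQ.exists_slater {ιE ιI : Type*} {a : ιE → EuclideanSpace ℝ (Fin n)}
    {b : ιE → ℝ} {ω : ιI → EuclideanSpace ℝ (Fin n) → ℝ} (hMFCQ : GeneralizedMFCQ a b ω G H)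
    (hX : Convex ℝ (constraintSet a b ω)) (hG : ∀ i, ConvexOn ℝ Set.univ (G i))
    (hGc : ∀ i, Continuous (G i)) {z : EuclideanSpace ℝ (Fin n)}
    (hz : z ∈ feasibleSet (constraintSet a b ω) G H) {sH : Fin K → EuclideanSpace ℝ (Fin n)}
    (hsH : ∀ i, sH i ∈ subdiff Set.univ (H i) z) :
    ∃ y ∈ constraintSet a b ω, ∀ i, G i y - H i z - ⟪sH i, y - z⟫_ℝ < 0 := by
  by_cases hact : ∃ i, G i z = H i z
  · obtain ⟨y, hy, hyG, -⟩ := hMFCQ z hz hact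
    -- Move slightly from `z` towards `y`: convexity handles active constraints, continuity the
    -- inactive ones.
    have hev : ∀ i, ∀ᶠ t : ℝ in 𝓝[>] 0,
        G i ((1 - t) • z + t • y) - H i z - ⟪sH i, (1 - t) • z + t • y - z⟫_ℝ < 0 := by
      intro i
      by_cases hi : G i z = H i z
      · filter_upwards [Ioc_mem_nhdsGT (zero_lt_one' ℝ)] with t ht
        have h1 := (convexOn_linearized convex_univ (hG i) (H i z) (sH i) z).2 (Set.mem_univ z)
          (Set.mem_univ y) (sub_nonneg.2 ht.2) ht.1.le (by ring)
        have h2 := mul_neg_of_pos_of_neg ht.1 (hyG i hi (sH i) (hsH i))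
        simp only [smul_eq_mul, sub_self, inner_zero_right, hi, mul_zero, zero_add] at h1
        exact h1.trans_lt h2
      · have hlt : G i z - H i z < 0 := lt_of_le_of_ne (hz.2 i) (sub_ne_zero.2 hi)
        have hGi := hGc i
        have hcont : Continuous fun t : ℝ =>
            G i ((1 - t) • z + t • y) - H i z - ⟪sH i, (1 - t) • z + t • y - z⟫_ℝ := by
          fun_prop
        have ht := (hcont.tendsto 0).mono_left (nhdsWithin_le_nhds (s := Set.Ioi 0))
        refine ht.eventually_lt_const ?_
        simpa using hlt
    obtain ⟨t, ht, ht01⟩ := ((eventually_all.2 hev).and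
      (Ioc_mem_nhdsGT (zero_lt_one' ℝ))).exists
    exact ⟨_, hX hz.1 hy (sub_nonneg.2 ht01.2) ht01.1.le (by ring), ht⟩
  · push Not at hact
    exact ⟨z, hz.1, fun i => by
      simpa using lt_of_le_of_ne (hz.2 i) (sub_ne_zero.2 (hact i))⟩

/-- A feasible point that minimizes the linearized objective over the strictly feasible points of
the convexified constraints is a KKT point. -/
theorem isKKTPoint_of_forall_le (hX : Convex ℝ X) (hU : IsOpen U) (hXU : X ⊆ U)
    (hg : ConvexOn ℝ U g) (hgc : ContinuousOn g U) (hG : ∀ i, ConvexOn ℝ Set.univ (G i))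
    (hGc : ∀ i, Continuous (G i)) {z sh : EuclideanSpace ℝ (Fin n)}
    {sH : Fin K → EuclideanSpace ℝ (Fin n)} (hz : z ∈ feasibleSet X G H)
    (hsh : sh ∈ subdiff U h z) (hsH : ∀ i, sH i ∈ subdiff Set.univ (H i) z)
    (hslater : ∃ y ∈ X, ∀ i, G i y - H i z - ⟪sH i, y - z⟫_ℝ < 0)
    (hmin : ∀ y ∈ X, (∀ i, G i y - H i z - ⟪sH i, y - z⟫_ℝ < 0) →
      g z ≤ g y - ⟪sh, y - z⟫_ℝ) :
    IsKKTPoint X U g h G H z := by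
  obtain ⟨y₀, hy₀, hy₀G⟩ := hslater
  have hc : ∀ i, ConvexOn ℝ X (fun y => G i y - H i z - ⟪sH i, y - z⟫_ℝ) := fun i =>
    convexOn_linearized hX ((hG i).subset (Set.subset_univ _) hX) _ _ _
  have hF : ConvexOn ℝ X (fun y => g y - ⟪sh, y - z⟫_ℝ) := by
    simpa using convexOn_linearized hX (hg.subset hXU hX) 0 sh z
  obtain ⟨l, hl, hlmin⟩ := exists_lagrange_multipliers hF hc hy₀ hy₀G hmin
  have hterm : ∀ i ∈ Finset.univ, l i * (G i z - H i z) ≤ 0 := fun i _ =>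
    mul_nonpos_of_nonneg_of_nonpos (hl i) (hz.2 i)
  have hsum : ∑ i, l i * (G i z - H i z) = 0 := by
    refine le_antisymm (Finset.sum_nonpos hterm) ?_
    have h1 := hlmin z hz.1
    simp only [sub_self, inner_zero_right, sub_zero] at h1
    linarith
  have hcompl : ∀ i, l i * (G i z - H i z) = 0 := fun i =>
    (Finset.sum_eq_zero_iff_of_nonpos hterm).1 hsum i (Finset.mem_univ i)
  have hlG : ∀ i, ConvexOn ℝ Set.univ (fun y => l i * G i y) := fun i => (hG i).smul (hl i)
  -- `w` gathers all linear terms, leaving `g`, the `l i * G i` and `-⟪w, ·⟫` to be split.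
  set w := sh + ∑ i, l i • sH i
  have hw : ∀ y, ⟪w, y⟫_ℝ = ⟪sh, y⟫_ℝ + ∑ i, l i * ⟪sH i, y⟫_ℝ := fun y => by
    simp only [w, inner_add_left, sum_inner, real_inner_smul_left]
  have hlin : ConvexOn ℝ X (fun y => -⟪w, y⟫_ℝ) := by
    simpa using convexOn_linearized hX (convexOn_const 0 hX) 0 w 0
  have hlag : ∀ y ∈ X, g z + (∑ i, l i * G i z + -⟪w, z⟫_ℝ)
      ≤ g y + (∑ i, l i * G i y + -⟪w, y⟫_ℝ) := by
    intro y hy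
    have h1 := hlmin y hy
    have h2 : ∑ i, l i * (G i y - H i z - ⟪sH i, y - z⟫_ℝ)
        = ∑ i, l i * G i y - ∑ i, l i * H i z
          - (∑ i, l i * ⟪sH i, y⟫_ℝ - ∑ i, l i * ⟪sH i, z⟫_ℝ) := by
      simp only [← Finset.sum_sub_distrib, inner_sub_right]
      exact Finset.sum_congr rfl fun i _ => by ring
    have h3 : ∑ i, l i * G i z - ∑ i, l i * H i z = 0 := by
      rw [← hsum, ← Finset.sum_sub_distrib]
      exact Finset.sum_congr rfl fun i _ => by ring
    rw [h2, inner_sub_right] at h1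
    rw [hw, hw]
    linarith
  have hψ : ConvexOn ℝ X (fun y => ∑ i, l i * G i y + -⟪w, y⟫_ℝ) := by
    refine ConvexOn.add ?_ hlin
    have h1 : ConvexOn ℝ X (∑ i, fun y => l i * G i y) :=
      Finset.sum_induction _ (ConvexOn ℝ X) (fun _ _ => ConvexOn.add) (convexOn_const 0 hX)
        fun i _ => (hlG i).subset (Set.subset_univ _) hX
    refine h1.congr fun y _ => ?_
    rw [Finset.sum_apply]
  obtain ⟨sg, hsg, hsgψ⟩ := exists_subdiff_of_isMinOn_add hU hg hgc hψ hXU hz.1 hlag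
  have hlin' : ConvexOn ℝ X (fun y => -⟪w, y⟫_ℝ + ⟪sg, y⟫_ℝ) := by
    have h1 := convexOn_linearized hX hlin 0 (-sg) 0
    simpa using h1
  obtain ⟨sG, hsG, hsGψ⟩ := exists_subdiff_of_isMinOn_sum Finset.univ hlG
    (fun i => continuous_const.mul (hGc i)) hz.1 hlin' (by
      intro y hy
      have h1 := hsgψ y hy
      simp only [inner_neg_left, inner_sub_right] at h1
      linarith)
  choose tG htG hsGtG using fun i =>
    exists_smul_eq_of_mem_subdiff_mul (hl i) (hG i) (hGc i) (hsG i)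
  refine ⟨hz, l, hl, hcompl, sg, hsg, sh, hsh, tG, htG, sH, hsH, w - sg - ∑ i, sG i, ?_, ?_⟩
  · intro y hy
    have h1 := hsGψ y hy
    simp only [inner_neg_left, inner_sub_right, inner_sub_left] at h1 ⊢
    linarith
  · simp only [smul_sub, Finset.sum_sub_distrib, w, hsGtG]
    abel

end Algorithm

end ProxDC


/-! ### Passage to the limit -/

theorem mainTheorem6 {n K : ℕ} {ιE ιI : Type*} [Finite ιE] [Finite ιI]
    (a : ιE → EuclideanSpace ℝ (Fin n)) (b : ιE → ℝ)
    (ω : ιI → EuclideanSpace ℝ (Fin n) → ℝ)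
    (hω_convex : ∀ j, ConvexOn ℝ Set.univ (ω j)) (hω_smooth : ∀ j, ContDiff ℝ 1 (ω j))
    (X : Set (EuclideanSpace ℝ (Fin n))) (hX : X = ProxDC.constraintSet a b ω)
    (U : Set (EuclideanSpace ℝ (Fin n))) (hU : IsOpen U) (hXU : X ⊆ U)
    (g h : EuclideanSpace ℝ (Fin n) → ℝ) (ρ β : ℝ) (hρ : 0 ≤ ρ) (hβ : 0 ≤ β)
    (hρβ : 0 < ρ + β)
    (hg_cont : ContinuousOn g U) (hg_convex : ConvexOn ℝ U g)
    (hg_strong : StrongConvexOn U ρ g)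
    (hh_cont : ContinuousOn h U) (hh_convex : ConvexOn ℝ U h)
    (G H : Fin K → EuclideanSpace ℝ (Fin n) → ℝ)
    (hG_cont : ∀ i, Continuous (G i)) (hG_convex : ∀ i, ConvexOn ℝ Set.univ (G i))
    (hH_cont : ∀ i, Continuous (H i)) (hH_convex : ∀ i, ConvexOn ℝ Set.univ (H i))
    (hMFCQ : ProxDC.GeneralizedMFCQ a b ω G H)
    (x : ℕ → EuclideanSpace ℝ (Fin n))
    (hx : ProxDC.IsProxDCSequence X U g h G H β x)
    (hbdd : Bornology.IsBounded
      {y | y ∈ X ∧ g y - h y ≤ g (x 0) - h (x 0) ∧ ∀ i, G i y - H i y ≤ 0})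
    (xstar : EuclideanSpace ℝ (Fin n)) (hxstar : MapClusterPt xstar atTop x) :
    ProxDC.IsKKTPoint X U g h G H xstar := by
  classical
  have hXconv : Convex ℝ X := hX ▸ ProxDC.convex_constraintSet hω_convex
  have hXclosed : IsClosed X :=
    hX ▸ ProxDC.isClosed_constraintSet fun j => (hω_smooth j).continuous
  obtain ⟨l, hl, hxl⟩ := mapClusterPt_iff_ultrafilter.1 hxstar
  have hfeas := hx.mem_feasibleSet
  have hmemX : xstar ∈ X := hXclosed.mem_of_tendsto hxl (Eventually.of_forall fun k => (hfeas k).1)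
  have hUx : U ∈ 𝓝 xstar := hU.mem_nhds (hXU hmemX)
  have hgx : ContinuousAt g xstar := hg_cont.continuousAt hUx
  have hhx : ContinuousAt h xstar := hh_cont.continuousAt hUx
  have hfeasx : xstar ∈ ProxDC.feasibleSet X G H := by
    refine ⟨hmemX, fun i => ?_⟩
    exact le_of_tendsto ((((hG_cont i).tendsto xstar).comp hxl).sub
      (((hH_cont i).tendsto xstar).comp hxl)) (Eventually.of_forall fun k => (hfeas k).2 i)
  -- An ultrafilter need not be shift invariant; vanishing steps are what make `x (k + 1)` converge
  -- along `l` too.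
  have hstep :=
    (hx.tendsto_norm_sub hXconv hXU hG_convex hg_strong hβ hρβ hl hxl hgx hhx).mono_left hl
  have hxl1 : Tendsto (fun k => x (k + 1)) l (𝓝 xstar) := by
    simpa using hstep.add hxl
  choose sh hsh sH hsH hmem hmin using hx.2
  obtain ⟨th, hth, hthl⟩ := ProxDC.exists_tendsto_subdiff hUx hhx hxl hsh
  choose tH htH htHl using fun i => ProxDC.exists_tendsto_subdiff univ_mem
    (hH_cont i).continuousAt hxl fun k => hsH k i
  have hHl : ∀ i, Tendsto (fun k => H i (x k)) l (𝓝 (H i xstar)) := fun i =>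
    ((hH_cont i).tendsto xstar).comp hxl
  have hslater : ∃ y ∈ X, ∀ i, G i y - H i xstar - ⟪tH i, y - xstar⟫_ℝ < 0 := by
    subst hX
    exact hMFCQ.exists_slater hXconv hG_convex hG_cont hfeasx htH
  have hstrict : ∀ y ∈ X, (∀ i, G i y - H i xstar - ⟪tH i, y - xstar⟫_ℝ < 0) →
      g xstar ≤ g y - ⟪th, y - xstar⟫_ℝ + β / 2 * ‖y - xstar‖ ^ 2 := by
    intro y hy hyG
    have hev : ∀ᶠ k in (l : Filter ℕ), y ∈ ProxDC.subproblemSet X G H (x k) (sH k) := by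
      have h1 : ∀ i, ∀ᶠ k in (l : Filter ℕ), G i y - H i (x k) - ⟪sH k i, y - x k⟫_ℝ < 0 :=
        fun i => ((tendsto_const_nhds.sub (hHl i)).sub
          ((htHl i).inner (tendsto_const_nhds.sub hxl))).eventually_lt_const (hyG i)
      filter_upwards [eventually_all.2 h1] with k hk using ⟨hy, fun i => (hk i).le⟩
    have hle : ∀ᶠ k in (l : Filter ℕ),
        g (x (k + 1)) - h (x k) - ⟪sh k, x (k + 1) - x k⟫_ℝ + β / 2 * ‖x (k + 1) - x k‖ ^ 2
          ≤ g y - h (x k) - ⟪sh k, y - x k⟫_ℝ + β / 2 * ‖y - x k‖ ^ 2 := by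
      filter_upwards [hev] with k hk using hmin k hk
    have hhl : Tendsto (fun k => h (x k)) l (𝓝 (h xstar)) := hhx.tendsto.comp hxl
    have hgl : Tendsto (fun k => g (x (k + 1))) l (𝓝 (g xstar)) := hgx.tendsto.comp hxl1
    have hyl : Tendsto (fun k => y - x k) l (𝓝 (y - xstar)) := tendsto_const_nhds.sub hxl
    have h1 := ((hgl.sub hhl).sub (hthl.inner hstep)).add
      ((hstep.norm.pow 2).const_mul (β / 2))
    have h2 := ((tendsto_const_nhds (x := g y)).sub hhl |>.sub (hthl.inner hyl)).add
      ((hyl.norm.pow 2).const_mul (β / 2))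
    have h3 := le_of_tendsto_of_tendsto h1 h2 hle
    simp only [inner_zero_right, norm_zero, ne_eq, OfNat.ofNat_ne_zero, not_false_eq_true, zero_pow,
      mul_zero, sub_zero, add_zero] at h3
    linarith
  refine ProxDC.isKKTPoint_of_forall_le hXconv hU hXU hg_convex hg_cont hG_convex hG_cont hfeasx
    hth htH hslater fun y hy hyG => ?_
  have hφ : ConvexOn ℝ X (fun y => g y - ⟪th, y - xstar⟫_ℝ) := by
    simpa using ProxDC.convexOn_linearized hXconv (hg_convex.subset hXU hXconv) 0 th xstar
  -- Points with `t > 0` on the segment from the feasible `xstar` to a strictly feasible `y` are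
  -- strictly feasible, so `hstrict` applies.
  have h1 := ProxDC.le_of_le_add_sq (β := β) hφ hmemX hy fun t ht ht1 => by
    have h2 := hstrict _ (hXconv hmemX hy (sub_nonneg.2 ht1) ht.le (by ring)) fun i => by
      have h3 := (ProxDC.convexOn_linearized convex_univ (hG_convex i) (H i xstar) (tH i) xstar).2
        (Set.mem_univ xstar) (Set.mem_univ y) (sub_nonneg.2 ht1) ht.le (by ring)
      simp only [smul_eq_mul, sub_self, inner_zero_right, sub_zero] at h3
      have h4 := mul_neg_of_pos_of_neg ht (hyG i)
      have h5 := mul_nonpos_of_nonneg_of_nonpos (sub_nonneg.2 ht1) (hfeasx.2 i)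
      linarith
    simpa using h2
  simpa using h1
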